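/- **Theorem.** All graphs are finite and simple. For a graph $G$ and an integer $k\ge 1$, say that $G$ is a $(k,\alpha)$-multitasker ($0<\alpha\le 1$) if every matching $M$ of $G$ with $|M|=k$ contains an induced matching $M'\subseteq M$ of $G$ (i.e. the only edges of $G$ among the vertices covered by $M'$ are those of $M'$) with $|M'|\ge\alpha|M|$. Let $\alpha_k(G)$ be the largest $\alpha\in(0,1]$ such that $G$ is a $(k,\alpha)$-multitasker if $G$ has a matching of size $k$, and $\alpha_k(G)=1$ otherwise. For real $k\geq 0$ let $\alpha_{\le k}(G)=\min_{\ell\in\mathbb N,\,1\le\ell\le k}\alpha_\ell(G)$ (with value $1$ if $k<1$). There are absolute constants $N\in\mathbb N$ and $C>0$ such that the following holds for all positive integers $d\le n$ with $n\ge N$ and all $\epsilon\in(0,1)$ with $\epsilon\ge \frac{20\log d}{\log n}$. Put $$k=\Bigl(\frac{1}{101e^5}\Bigr)^{4/\epsilon}\cdot\frac{n}{d^{1+8/\epsilon}} .$$ Then there is a bipartite graph $G$ with $n$ vertices on each side and average degree at least $d/2$ such that $$\alpha_{\le k}(G)\ \ge\ \tfrac12-\epsilon .$$ Moreover, if $d\ge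 2$, then $k=n/d^{1+\theta}$ for some $0\le\theta\le C/\epsilon$ (that is, $k=n/d^{1+O(1/\epsilon)}$). -/

import Mathlib

namespace Multitasking

/-- The average degree of a finite graph. -/
noncomputable def averageDegree {V : Type*} [Fintype V] (G : SimpleGraph V) : ℝ :=
  open Classical in (∑ v : V, (G.degree v : ℝ)) / (Fintype.card V : ℝ)

/-- `M` is a matching of `G` with exactly `k` edges. -/
def IsMatchingOfSize {V : Type*} {G : SimpleGraph V} (M : G.Subgraph) (k : ℕ) : Prop :=
  M.IsMatching ∧ M.edgeSet.ncard = k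

/-- `M` is an induced matching of `G`: a matching such that every edge of `G` between two
vertices covered by `M` belongs to `M`. -/
def IsInducedMatching {V : Type*} {G : SimpleGraph V} (M : G.Subgraph) : Prop :=
  M.IsMatching ∧ M.IsInduced

/-- `G` is a `(k, α)`-multitasker: every matching `M` of size `k` contains an induced matching
`M'` of `G` with `|M'| ≥ α |M|`. -/
def IsMultitasker {V : Type*} (G : SimpleGraph V) (k : ℕ) (α : ℝ) : Prop :=
  ∀ M : G.Subgraph, IsMatchingOfSize M k →
    ∃ M' : G.Subgraph, M' ≤ M ∧ IsInducedMatching M' ∧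
      α * (M.edgeSet.ncard : ℝ) ≤ (M'.edgeSet.ncard : ℝ)

open Classical in
/-- The multitasking capacity `α_k(G)` for matchings of size `k`: the largest `α ∈ (0, 1]` such
that `G` is a `(k, α)`-multitasker if `G` has a matching of size `k`, and `1` otherwise.
(For `k ≥ 1` the supremum is attained: a single edge of a matching is an induced matching, and
the sizes of the matchings involved are integers between `0` and `k`.) -/
noncomputable def capacity {V : Type*} (G : SimpleGraph V) (k : ℕ) : ℝ :=
  if ∃ M : G.Subgraph, IsMatchingOfSize M k then
    sSup {α : ℝ | 0 < α ∧ α ≤ 1 ∧ IsMultitasker G k α}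
  else 1

/-- The multitasking capacity `α_{≤ k}(G) = min_{1 ≤ ℓ ≤ k} α_ℓ(G)` for matchings of size at
most `k` (equal to `1` when `k = 0`, where there is no constraint). -/
noncomputable def capacityLE {V : Type*} (G : SimpleGraph V) (k : ℕ) : ℝ :=
  if h : (Finset.Icc 1 k).Nonempty then (Finset.Icc 1 k).inf' h (fun l => capacity G l) else 1

/-- The real number `(1 / (101 e⁵))^{4/ε} · n / d^{1 + 8/ε}`. -/
noncomputable def sizeBound (n d : ℕ) (ε : ℝ) : ℝ :=
  (1 / (101 * Real.exp 5)) ^ (4 / ε) * ((n : ℝ) / (d : ℝ) ^ (1 + 8 / ε))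

end Multitasking

/-! Contract each edge of a matching `M` to a point, joining two points when `G` has an edge between
the corresponding matching edges. Independent sets of this graph are exactly the induced
submatchings of `M`. If any `s ≤ k` left and `s` right vertices of `G` span at most `(2 + 2ε)s - 1`
edges, then the `s` matching edges among them are contracted away, so any `s` points span at most
`(1 + 2ε)s - 1` edges. Each component is thus a tree plus few edges, and deleting an endpoint of
every extra edge leaves a bipartite graph, with an independent set of proportion `1/2 - ε`
(`exists_isIndepSet_of_locally_sparse`, `IsLocallySparse.isMultitasker`). Such a `G` comes from the
first moment method with alterations: every left vertex picks `d` right vertices at random, with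
repetition. The expected number of overly dense configurations is at most `nd/2`, so deleting one
edge slot from each keeps half of the slots (`exists_fun_hitting_set`, `exists_sparse_fun`,
`exists_isLocallySparse`). -/

open SimpleGraph

/-! ### Independent sets in locally sparse graphs -/

/-- A connected graph with `v` vertices and `e` edges has an independent set of size at least
`(2 * v - e - 1) / 2`: delete one endpoint of every edge outside a spanning tree. -/
lemma exists_isIndepSet_of_connected {W : Type*} [Finite W] (H : SimpleGraph W)
    (hH : H.Connected) :
    ∃ I : Set W, H.IsIndepSet I ∧ 2 * Nat.card W ≤ 2 * I.ncard + H.edgeSet.ncard + 1 := by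
  classical
  have := Fintype.ofFinite W
  obtain ⟨T, hle, hT⟩ := hH.exists_isTree_le
  have hTc : T.edgeSet.ncard + 1 = Nat.card W := by
    rw [Nat.card_eq_fintype_card, ← hT.card_edgeFinset, ← coe_edgeFinset, Set.ncard_coe_finset]
  let C := hT.coloringTwo
  have hdiff : (H.edgeSet \ T.edgeSet).ncard + T.edgeSet.ncard = H.edgeSet.ncard :=
    Set.ncard_sdiff_add_ncard_of_subset (edgeSet_mono hle)
  let X : Set W := (fun e : Sym2 W => e.out.1) '' (H.edgeSet \ T.edgeSet)
  have hX : X.ncard ≤ (H.edgeSet \ T.edgeSet).ncard := Set.ncard_image_le (Set.toFinite _)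
  have hindep : ∀ c : Fin 2, H.IsIndepSet {w | w ∉ X ∧ C w = c} := by
    intro c u hu v hv _ huv
    by_cases hT' : T.Adj u v
    · exact C.valid hT' (hu.2.trans hv.2.symm)
    · have hmem : (s(u, v) : Sym2 W).out.1 ∈ X := ⟨s(u, v), ⟨huv, hT'⟩, rfl⟩
      have h2 : (s(u, v) : Sym2 W).out.1 ∈ s(u, v) := Sym2.out_fst_mem _
      rcases Sym2.mem_iff.1 h2 with h | h
      · exact hu.1 (h ▸ hmem)
      · exact hv.1 (h ▸ hmem)
  have hcover : Nat.card W ≤ X.ncard + ({w | w ∉ X ∧ C w = 0}.ncard +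
      {w | w ∉ X ∧ C w = 1}.ncard) := by
    rw [← Set.ncard_univ]
    refine (Set.ncard_le_ncard (t := X ∪ ({w | w ∉ X ∧ C w = 0} ∪ {w | w ∉ X ∧ C w = 1}))
      ?_ (Set.toFinite _)).trans ((Set.ncard_union_le _ _).trans
        (Nat.add_le_add_left (Set.ncard_union_le _ _) _))
    intro w _
    by_cases hw : w ∈ X
    · exact Or.inl hw
    · refine Or.inr ?_
      rcases Fin.exists_fin_two.1 ⟨C w, rfl⟩ with h | h
      · exact Or.inl ⟨hw, h⟩
      · exact Or.inr ⟨hw, h⟩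
  rcases le_total {w | w ∉ X ∧ C w = 0}.ncard {w | w ∉ X ∧ C w = 1}.ncard with h | h
  · exact ⟨_, hindep 1, by omega⟩
  · exact ⟨_, hindep 0, by omega⟩

/-- If every nonempty `T ⊆ S` spans at most `(1 + β) |T| - 1` edges, then `S` contains an
independent set of size at least `(1 - β) |S| / 2`. -/
lemma exists_isIndepSet_of_locally_sparse {V : Type*} [Finite V] (H : SimpleGraph V) (β : ℝ)
    (S : Set V) (hS : ∀ T ⊆ S, T.Nonempty →
      ((H.induce T).edgeSet.ncard : ℝ) + 1 ≤ (1 + β) * T.ncard) :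
    ∃ I ⊆ S, H.IsIndepSet I ∧ (1 - β) * S.ncard ≤ 2 * I.ncard := by
  induction hm : S.ncard using Nat.strong_induction_on generalizing S with
  | _ m ih =>
    subst hm
    rcases S.eq_empty_or_nonempty with rfl | hne
    · exact ⟨∅, subset_rfl, by simp [IsIndepSet], by simp⟩
    by_cases hconn : (H.induce S).Connected
    · obtain ⟨I, hI, hcard⟩ := exists_isIndepSet_of_connected _ hconn
      refine ⟨Subtype.val '' I, by simp, ?_, ?_⟩
      · rintro _ ⟨u, hu, rfl⟩ _ ⟨v, hv, rfl⟩ huv hadj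
        exact hI hu hv (fun h => huv (congrArg _ h)) hadj
      · rw [Set.ncard_image_of_injective _ Subtype.val_injective]
        rw [Nat.card_coe_set_eq] at hcard
        have h1 := hS S subset_rfl hne
        have h2 : (2 * S.ncard : ℝ) ≤ 2 * I.ncard + (H.induce S).edgeSet.ncard + 1 := by
          exact_mod_cast hcard
        linarith
    -- The estimate is additive over components, so it suffices to split off the component of `x`
    -- and recurse. Connectedness is needed only for the `- 1` in the hypothesis to cancel the
    -- spanning tree's `+ 1`.
    · have : ∃ x y : S, ¬ (H.induce S).Reachable x y := by
        by_contra! h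
        have := hne.to_subtype
        exact hconn ⟨h⟩
      obtain ⟨x, y, hxy⟩ := this
      let A : Set V := Subtype.val '' {z : S | (H.induce S).Reachable x z}
      have hAS : A ⊆ S := by simp [A]
      have hxA : (x : V) ∈ A := ⟨x, Reachable.refl _, rfl⟩
      have hyA : (y : V) ∉ A := by
        rintro ⟨z, hz, hzy⟩
        exact hxy (Subtype.ext hzy ▸ hz)
      have hsep : ∀ u ∈ A, ∀ v ∈ S \ A, ¬ H.Adj u v := by
        rintro _ ⟨u, hu, rfl⟩ v ⟨hvS, hvA⟩ huv
        exact hvA ⟨⟨v, hvS⟩, hu.trans (Adj.reachable (G := H.induce S) huv), rfl⟩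
      obtain ⟨I, hIA, hI, hIc⟩ := ih A.ncard
        (Set.ncard_lt_ncard ⟨hAS, fun h => hyA (h y.2)⟩) A
        (fun T hT => hS T (hT.trans hAS)) rfl
      obtain ⟨J, hJA, hJ, hJc⟩ := ih (S \ A).ncard
        (Set.ncard_lt_ncard ⟨Set.sdiff_subset, fun h => (h x.2).2 hxA⟩) (S \ A)
        (fun T hT => hS T (hT.trans Set.sdiff_subset)) rfl
      refine ⟨I ∪ J, Set.union_subset (hIA.trans hAS) (hJA.trans Set.sdiff_subset), ?_, ?_⟩
      · rintro u (hu | hu) v (hv | hv) huv hadj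
        · exact hI hu hv huv hadj
        · exact hsep u (hIA hu) v (hJA hv) hadj
        · exact hsep v (hIA hv) u (hJA hu) hadj.symm
        · exact hJ hu hv huv hadj
      · have hd : Disjoint I J := Set.disjoint_left.2 fun u hu hv => (hJA hv).2 (hIA hu)
        rw [Set.ncard_union_eq hd]
        have := Set.ncard_sdiff_add_ncard_of_subset hAS
        rw [← this]
        push_cast
        linarith

/-- The diagonal supplies `S.ncard` of the pairs, and every edge of the symmetrized relation comes
from at least one off-diagonal pair. In the application the diagonal pairs are the matching edges.
-/
lemma ncard_edgeSet_induce_fromRel_add_le {V : Type*} [Finite V] (R : V → V → Prop) (S : Set V)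
    (hR : ∀ a ∈ S, R a a) :
    ((fromRel R).induce S).edgeSet.ncard + S.ncard ≤
      {p : V × V | p.1 ∈ S ∧ p.2 ∈ S ∧ R p.1 p.2}.ncard := by
  set P := {p : V × V | p.1 ∈ S ∧ p.2 ∈ S ∧ R p.1 p.2} with hP
  let D : Set (V × V) := (fun a => (a, a)) '' S
  have hD : D.ncard = S.ncard :=
    Set.ncard_image_of_injective _ fun a b h => congrArg Prod.fst h
  have hDP : D ⊆ P := by
    rintro _ ⟨a, ha, rfl⟩
    exact ⟨ha, ha, hR a ha⟩
  rw [← Set.ncard_sdiff_add_ncard_of_subset hDP, hD]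
  refine Nat.add_le_add_right ?_ _
  rw [← Set.ncard_image_of_injective _ (Sym2.map.injective (Subtype.val_injective (p := S)))]
  refine (Set.ncard_le_ncard (t := (fun p : V × V => s(p.1, p.2)) '' (P \ D)) ?_
    (Set.toFinite _)).trans (Set.ncard_image_le (Set.toFinite _))
  rintro _ ⟨e, he, rfl⟩
  induction e with | _ u v => ?_
  have he' : u.1 ≠ v.1 ∧ (R u.1 v.1 ∨ R v.1 u.1) := he
  rcases he'.2 with h | h
  · exact ⟨(u.1, v.1), ⟨⟨u.2, v.2, h⟩, by rintro ⟨a, _, ha⟩; simp at ha; grind⟩, rfl⟩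
  · exact ⟨(v.1, u.1), ⟨⟨v.2, u.2, h⟩, by rintro ⟨a, _, ha⟩; simp at ha; grind⟩, Sym2.eq_swap⟩

/-! ### From local sparsity to induced matchings -/

namespace Multitasking

/-- Every pair of sets of `s` vertices on the two sides, with `1 ≤ s ≤ k`, spans at most
`(2 + β) s - 1` edges. -/
def IsLocallySparse {α γ : Type*} (G : SimpleGraph (α ⊕ γ)) (k : ℕ) (β : ℝ) : Prop :=
  ∀ (A : Set α) (B : Set γ), A.ncard = B.ncard → A.Nonempty → A.ncard ≤ k →
    ({p : α × γ | p.1 ∈ A ∧ p.2 ∈ B ∧ G.Adj (Sum.inl p.1) (Sum.inr p.2)}.ncard : ℝ) + 1 ≤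
      (2 + β) * A.ncard

variable {α γ : Type*} {G : SimpleGraph (α ⊕ γ)}

lemma ncard_edgeSet_of_isMatching
    (hG : G.IsBipartiteWith (Set.range Sum.inl) (Set.range Sum.inr)) {M : G.Subgraph}
    (hM : M.IsMatching) : M.edgeSet.ncard = {a : α | Sum.inl a ∈ M.verts}.ncard := by
  symm
  refine Set.ncard_congr (fun a ha => s(Sum.inl a, (hM ha).choose)) ?_ ?_ ?_
  · intro a ha
    exact (hM ha).choose_spec.1
  · intro a b ha hb h
    have h1 := (hM ha).choose_spec.1
    have h2 := (hM hb).choose_spec.1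
    rcases Sym2.eq_iff.1 h with h | h
    · exact Sum.inl_injective h.1
    · rw [← h.1] at h2
      rcases hG.mem_of_adj h2.adj_sub with h | h <;> simp at h
  · intro e he
    induction e with | _ u v => ?_
    have he' : M.Adj u v := he
    rcases hG.mem_of_adj he'.adj_sub with ⟨⟨a, rfl⟩, -⟩ | ⟨-, ⟨a, rfl⟩⟩
    · exact ⟨a, he'.fst_mem, by
        rw [hM.eq_of_adj_left (hM he'.fst_mem).choose_spec.1 he']⟩
    · exact ⟨a, he'.snd_mem, by
        rw [hM.eq_of_adj_left (hM he'.snd_mem).choose_spec.1 he'.symm, Sym2.eq_swap]⟩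

lemma IsLocallySparse.isMultitasker [Finite α] [Finite γ] {k l : ℕ} {β : ℝ}
    (hG : G.IsBipartiteWith (Set.range Sum.inl) (Set.range Sum.inr))
    (hs : IsLocallySparse G k β) (hl : l ≤ k) : IsMultitasker G l ((1 - β) / 2) := by
  classical
  rintro M ⟨hM, hMl⟩
  have hMc := ncard_edgeSet_of_isMatching hG hM
  set L : Set α := {a : α | Sum.inl a ∈ M.verts} with hL
  have hpart : ∀ a : α, ∃ w : α ⊕ γ, a ∈ L → M.Adj (Sum.inl a) w := fun a => by
    by_cases ha : a ∈ L
    · exact ⟨_, fun _ => (hM ha).choose_spec.1⟩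
    · exact ⟨Sum.inl a, fun h => absurd h ha⟩
  choose π hπ using hpart
  have hπr : ∀ a ∈ L, ∃ b, Sum.inr b = π a := fun a ha => by
    rcases hG.mem_of_adj (hπ a ha).adj_sub with ⟨-, h⟩ | ⟨⟨b, h⟩, -⟩
    · exact h
    · simp at h
  have hinj : ∀ a ∈ L, ∀ b ∈ L, π a = π b → a = b := fun a ha b hb h =>
    Sum.inl_injective (hM.eq_of_adj_right (hπ a ha) (h ▸ hπ b hb))
  -- `fromRel R` is the contracted graph, with each matching edge named by its left endpoint and `π`
  -- giving the right endpoint.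
  let R : α → α → Prop := fun a b => G.Adj (Sum.inl a) (π b)
  obtain ⟨I, hIL, hI, hIc⟩ := exists_isIndepSet_of_locally_sparse (fromRel R) β L (by
    intro T hT hne
    have h1 := ncard_edgeSet_induce_fromRel_add_le R T fun a ha => (hπ a (hT ha)).adj_sub
    let B : Set γ := Sum.inr ⁻¹' (π '' T)
    have hB : B.ncard = T.ncard := by
      rw [Set.ncard_preimage_of_injective_subset_range Sum.inr_injective,
        Set.InjOn.ncard_image fun a ha b hb h => hinj a (hT ha) b (hT hb) h]
      rintro _ ⟨a, ha, rfl⟩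
      exact hπr a (hT ha)
    have h2 := hs T B hB.symm hne ((Set.ncard_le_ncard hT).trans (by omega))
    have h3 : {p : α × α | p.1 ∈ T ∧ p.2 ∈ T ∧ R p.1 p.2}.ncard ≤
        {p : α × γ | p.1 ∈ T ∧ p.2 ∈ B ∧ G.Adj (Sum.inl p.1) (Sum.inr p.2)}.ncard := by
      -- The injection sends `(a, b)` to `a` and the partner of `b`; the second alternative is a
      -- junk value outside `L`.
      have hex : ∀ p : α × α, ∃ q : α × γ, q.1 = p.1 ∧ (p.2 ∈ L → Sum.inr q.2 = π p.2) ∨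
          p.2 ∉ L := by
        intro p
        by_cases hp : p.2 ∈ L
        · obtain ⟨b, hb⟩ := hπr _ hp
          exact ⟨(p.1, b), Or.inl ⟨rfl, fun _ => hb⟩⟩
        · obtain ⟨a, ha⟩ := hne
          obtain ⟨b, -⟩ := hπr a (hT ha)
          exact ⟨(a, b), Or.inr hp⟩
      choose φ hφ using hex
      have hφ' : ∀ p : α × α, p.2 ∈ L → (φ p).1 = p.1 ∧ Sum.inr (φ p).2 = π p.2 :=
        fun p hp => by
          rcases hφ p with h | h
          · exact ⟨h.1, h.2 hp⟩
          · exact absurd hp h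
      refine Set.ncard_le_ncard_of_injOn φ ?_ ?_
      · rintro p ⟨h1, h2, h3⟩
        obtain ⟨h4, h5⟩ := hφ' p (hT h2)
        refine ⟨h4 ▸ h1, ⟨p.2, h2, h5.symm⟩, ?_⟩
        rw [h4, h5]
        exact h3
      · rintro p ⟨_, h2, _⟩ q ⟨_, h2', _⟩ hpq
        obtain ⟨h4, h5⟩ := hφ' p (hT h2)
        obtain ⟨h6, h7⟩ := hφ' q (hT h2')
        refine Prod.ext (by rw [← h4, ← h6, hpq]) (hinj _ (hT h2) _ (hT h2') ?_)
        rw [← h5, ← h7, hpq]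
    have h4 : (((fromRel R).induce T).edgeSet.ncard : ℝ) + T.ncard ≤
        ({p : α × γ | p.1 ∈ T ∧ p.2 ∈ B ∧ G.Adj (Sum.inl p.1) (Sum.inr p.2)}.ncard : ℝ) := by
      exact_mod_cast h1.trans h3
    linarith)
  let s : Set (α ⊕ γ) := Sum.inl '' I ∪ π '' I
  have hadj : ∀ a ∈ I, M.Adj (Sum.inl a) (π a) := fun a ha => hπ a (hIL ha)
  have hmem : ∀ a, Sum.inl a ∈ s → a ∈ I := by
    rintro a (⟨b, hb, hab⟩ | ⟨b, hb, hab⟩)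
    · exact Sum.inl_injective hab ▸ hb
    · obtain ⟨c, hc⟩ := hπr b (hIL hb)
      rw [← hc] at hab
      simp at hab
  have hsM : s ⊆ M.verts := by
    rintro _ (⟨b, hb, rfl⟩ | ⟨b, hb, rfl⟩)
    · exact (hadj b hb).fst_mem
    · exact (hadj b hb).snd_mem
  have hind : ∀ a ∈ I, ∀ w ∈ s, G.Adj (Sum.inl a) w → w = π a := by
    rintro a ha _ (⟨b, hb, rfl⟩ | ⟨b, hb, rfl⟩) h
    · rcases hG.mem_of_adj h with h | h <;> simp at h
    · by_contra hne
      have hab : a ≠ b := fun h => hne (h ▸ rfl)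
      exact hI ha hb hab ⟨hab, Or.inl h⟩
  have hle : M.induce s ≤ M := ⟨hsM, fun _ _ h => h.2.2⟩
  have hmatch : (M.induce s).IsMatching := by
    rintro _ (⟨b, hb, rfl⟩ | ⟨b, hb, rfl⟩)
    · exact ⟨π b, ⟨Or.inl ⟨b, hb, rfl⟩, Or.inr ⟨b, hb, rfl⟩, hadj b hb⟩, fun w hw =>
        hM.eq_of_adj_left hw.2.2 (hadj b hb)⟩
    · exact ⟨Sum.inl b, ⟨Or.inr ⟨b, hb, rfl⟩, Or.inl ⟨b, hb, rfl⟩, (hadj b hb).symm⟩,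
        fun w hw => hM.eq_of_adj_left hw.2.2 (hadj b hb).symm⟩
  refine ⟨M.induce s, hle, ⟨hmatch, ?_⟩, ?_⟩
  · intro v hv w hw hvw
    have hv' : v ∈ s := hv
    have hw' : w ∈ s := hw
    refine ⟨hv', hw', ?_⟩
    rcases hG.mem_of_adj hvw with ⟨⟨a, rfl⟩, -⟩ | ⟨-, ⟨a, rfl⟩⟩
    · rw [hind a (hmem a hv') w hw' hvw]
      exact hadj a (hmem a hv')
    · rw [hind a (hmem a hw') v hv' hvw.symm]
      exact (hadj a (hmem a hw')).symm
  · have hc : {a : α | Sum.inl a ∈ (M.induce s).verts} = I := by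
      ext a
      exact ⟨hmem a, fun ha => Or.inl ⟨a, ha, rfl⟩⟩
    rw [ncard_edgeSet_of_isMatching hG hmatch, hMc, hc]
    linarith

lemma le_capacity {V : Type*} {H : SimpleGraph V} {l : ℕ} {a : ℝ} (ha : a ≤ 1)
    (h : IsMultitasker H l a) : a ≤ capacity H l := by
  unfold capacity
  split_ifs
  -- Only positive ratios belong to the set under the supremum, so `a ≤ 0` is covered by
  -- nonnegativity of `sSup`.
  · rcases le_or_gt a 0 with h0 | h0
    · exact h0.trans (Real.sSup_nonneg fun x hx => hx.1.le)
    · exact le_csSup ⟨1, fun x hx => hx.2.1⟩ ⟨h0, ha, h⟩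
  · exact ha

lemma le_capacityLE {V : Type*} {H : SimpleGraph V} {k : ℕ} {a : ℝ} (ha : a ≤ 1)
    (h : ∀ l, 1 ≤ l → l ≤ k → a ≤ capacity H l) : a ≤ capacityLE H k := by
  unfold capacityLE
  split_ifs with hk
  · exact Finset.le_inf' _ _ fun l hl => h l (Finset.mem_Icc.1 hl).1 (Finset.mem_Icc.1 hl).2
  · exact ha

lemma capacity_nonneg {V : Type*} (H : SimpleGraph V) (l : ℕ) : 0 ≤ capacity H l := by
  unfold capacity
  split_ifs
  · exact Real.sSup_nonneg fun x hx => hx.1.le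
  · exact zero_le_one

end Multitasking

/-! ### First moment estimates -/

lemma card_filter_forall_mem_eq {E Y : Type*} [Fintype E] [DecidableEq E] [Fintype Y]
    [DecidableEq Y] [Nonempty Y] (Q : Finset E) (B : Finset Y) :
    ((Finset.univ.filter fun f : E → Y => ∀ q ∈ Q, f q ∈ B).card : ℝ) =
      (Fintype.card Y : ℝ) ^ Fintype.card E * ((B.card : ℝ) / Fintype.card Y) ^ Q.card := by
  have h1 : (Finset.univ.filter fun f : E → Y => ∀ q ∈ Q, f q ∈ B) =
      Fintype.piFinset fun q => if q ∈ Q then B else Finset.univ := by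
    ext f
    simp only [Finset.mem_filter, Finset.mem_univ, true_and, Fintype.mem_piFinset]
    refine forall_congr' fun q => ?_
    by_cases hq : q ∈ Q <;> simp [hq]
  have hY : (Fintype.card Y : ℝ) ≠ 0 := by
    exact_mod_cast Fintype.card_ne_zero
  have h2 : ∀ q : E, (((if q ∈ Q then B else Finset.univ : Finset Y).card : ℕ) : ℝ) =
      Fintype.card Y * (if q ∈ Q then (B.card : ℝ) / Fintype.card Y else 1) := by
    intro q
    by_cases hq : q ∈ Q
    · simp only [hq, if_true]
      field_simp
    · simp [hq, Finset.card_univ]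
  rw [h1, Fintype.card_piFinset, Nat.cast_prod, Finset.prod_congr rfl fun q _ => h2 q,
    Finset.prod_mul_distrib, Finset.prod_const, Finset.card_univ, Finset.prod_ite_mem]
  simp [div_pow]

/-- First moment method with alterations: if the expected number of events `f '' Q i ⊆ B i`
under a uniformly random `f` is at most `K`, then some `f` admits a set `D` of at most `K` points
meeting all the `Q i` whose event occurs. -/
lemma exists_fun_hitting_set {E Y I : Type*} [Fintype E] [DecidableEq E] [Fintype Y]
    [Nonempty Y] (𝒮 : Finset I) (Q : I → Finset E) (B : I → Finset Y)
    (hQ : ∀ i ∈ 𝒮, (Q i).Nonempty) (K : ℝ)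
    (hK : ∑ i ∈ 𝒮, ((B i).card / Fintype.card Y : ℝ) ^ (Q i).card ≤ K) :
    ∃ (f : E → Y) (D : Finset E), (D.card : ℝ) ≤ K ∧
      ∀ i ∈ 𝒮, (∀ q ∈ Q i, f q ∈ B i) → ∃ q ∈ Q i, q ∈ D := by
  classical
  have hf : ∃ f : E → Y, ((𝒮.filter fun i => ∀ q ∈ Q i, f q ∈ B i).card : ℝ) ≤ K := by
    have h : ∑ f : E → Y, ((𝒮.filter fun i => ∀ q ∈ Q i, f q ∈ B i).card : ℝ) ≤
        ∑ _f : E → Y, K := by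
      simp only [Finset.card_filter, Nat.cast_sum]
      rw [Finset.sum_comm]
      have h3 : ∀ i ∈ 𝒮, ∑ f : E → Y, (((if ∀ q ∈ Q i, f q ∈ B i then 1 else 0 : ℕ)) : ℝ) =
          (Fintype.card Y : ℝ) ^ Fintype.card E *
            ((B i).card / Fintype.card Y : ℝ) ^ (Q i).card := by
        intro i _
        rw [← card_filter_forall_mem_eq, Finset.card_filter, Nat.cast_sum]
      rw [Finset.sum_congr rfl h3, ← Finset.mul_sum, Finset.sum_const, Finset.card_univ,
        Fintype.card_fun, nsmul_eq_mul]
      push_cast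
      gcongr
    obtain ⟨f, -, hf⟩ := Finset.exists_le_of_sum_le Finset.univ_nonempty h
    exact ⟨f, hf⟩
  obtain ⟨f, hf⟩ := hf
  -- `none` is the default for indices outside `𝒮`, since `E` may be empty.
  have hex : ∀ i, ∃ q : Option E, i ∈ 𝒮 → ∃ e ∈ Q i, q = some e := fun i => by
    by_cases hi : i ∈ 𝒮
    · obtain ⟨e, he⟩ := hQ i hi
      exact ⟨some e, fun _ => ⟨e, he, rfl⟩⟩
    · exact ⟨none, fun h => absurd h hi⟩
  choose c hc using hex
  refine ⟨f, ((𝒮.filter fun i => ∀ q ∈ Q i, f q ∈ B i).image c).eraseNone, ?_, ?_⟩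
  · refine le_trans ?_ hf
    exact_mod_cast (Finset.card_eraseNone_le _).trans Finset.card_image_le
  · intro i hi hif
    obtain ⟨e, he, hce⟩ := hc i hi
    refine ⟨e, he, Finset.mem_eraseNone.2 ?_⟩
    exact Finset.mem_image.2 ⟨i, Finset.mem_filter.2 ⟨hi, hif⟩, hce⟩

/-- This is the union bound for fixed `s`: choose both vertex sets and `2s + r` of the `sd` slots,
each landing in the right set with probability `s/n`. The powers of `n` cancel except for `n ^ r`;
the factorials cost `e^(4s)`, and `e⁴/4 ≤ 16`. -/
lemma choose_sq_mul_choose_mul_pow_le (n d s r : ℕ) (hn : 0 < n) :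
    (n.choose s : ℝ) ^ 2 * ((s * d).choose (2 * s + r) : ℝ) * ((s : ℝ) / n) ^ (2 * s + r) ≤
      (16 * (d : ℝ) ^ 2) ^ s * ((s : ℝ) * d / n) ^ r := by
  have hn' : (0 : ℝ) < n := by exact_mod_cast hn
  have h1 : (n.choose s : ℝ) ≤ (n : ℝ) ^ s / (s.factorial : ℝ) := Nat.choose_le_pow_div s n
  have h2 : ((s * d).choose (2 * s + r) : ℝ) ≤
      ((s : ℝ) * d) ^ (2 * s + r) / ((2 * s + r).factorial : ℝ) := by
    exact_mod_cast Nat.choose_le_pow_div (α := ℝ) (2 * s + r) (s * d)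
  have h3 : (s : ℝ) ^ s / (s.factorial : ℝ) ≤ Real.exp s :=
    Real.pow_div_factorial_le_exp _ (Nat.cast_nonneg s) s
  have h4 : (2 * (s : ℝ)) ^ (2 * s + r) / ((2 * s + r).factorial : ℝ) ≤ Real.exp (2 * s) :=
    Real.pow_div_factorial_le_exp _ (by positivity) _
  have h5 : Real.exp 4 ≤ 64 := by
    have h := Real.exp_one_lt_d9
    have h6 : Real.exp 4 = Real.exp 1 ^ 4 := by rw [← Real.exp_nat_mul]; norm_num
    rw [h6]
    calc Real.exp 1 ^ 4 ≤ 2.8 ^ 4 := by gcongr; linarith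
      _ ≤ 64 := by norm_num
  calc (n.choose s : ℝ) ^ 2 * ((s * d).choose (2 * s + r) : ℝ) * ((s : ℝ) / n) ^ (2 * s + r)
      ≤ ((n : ℝ) ^ s / (s.factorial : ℝ)) ^ 2 *
        (((s : ℝ) * d) ^ (2 * s + r) / ((2 * s + r).factorial : ℝ)) *
          ((s : ℝ) / n) ^ (2 * s + r) := by gcongr
    _ = ((s : ℝ) ^ s / (s.factorial : ℝ)) ^ 2 *
        ((2 * (s : ℝ)) ^ (2 * s + r) / ((2 * s + r).factorial : ℝ)) * (1 / 2 : ℝ) ^ (2 * s + r) *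
          ((d : ℝ) ^ 2) ^ s * ((s : ℝ) * d / n) ^ r := by
        have : (n : ℝ) ^ s ≠ 0 := by positivity
        simp only [div_pow, mul_pow, pow_add, pow_mul, one_pow]
        field_simp
        ring
    _ ≤ Real.exp s ^ 2 * Real.exp (2 * s) * (1 / 2 : ℝ) ^ (2 * s) *
          ((d : ℝ) ^ 2) ^ s * ((s : ℝ) * d / n) ^ r := by
        gcongr ?_ ^ 2 * ?_ * ?_ * _ * _
        exact pow_le_pow_of_le_one (by norm_num) (by norm_num) (by omega)
    _ = (Real.exp 4 / 4 * (d : ℝ) ^ 2) ^ s * ((s : ℝ) * d / n) ^ r := by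
        have h6 : Real.exp s ^ 2 * Real.exp (2 * s) = Real.exp 4 ^ s := by
          rw [← Real.exp_nat_mul, ← Real.exp_nat_mul, ← Real.exp_add]
          congr 1
          push_cast
          ring
        rw [h6, pow_mul, ← mul_pow, ← mul_pow]
        congr 2
        ring
    _ ≤ (16 * (d : ℝ) ^ 2) ^ s * ((s : ℝ) * d / n) ^ r := by
        gcongr
        linarith

/-- As `x ≤ a^(-1/ε)`, an excess of `2εs` would yield a factor `a^(-2s)`, beating `a^s`; rounding
down loses at most `a^(1/ε)`. The bound is uniform in `s`, so summing over `s ≤ k` costs only a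
factor `k`. -/
lemma pow_mul_pow_floor_le {a x ε : ℝ} (ha : 1 ≤ a) (hε : 0 < ε) (hx : 0 ≤ x)
    (hxa : x * a ^ (1 / ε) ≤ 1) (s : ℕ) : a ^ s * x ^ ⌊2 * ε * s⌋₊ ≤ a ^ (1 / ε) := by
  have ha0 : 0 < a := by linarith
  have h1 : x ≤ a ^ (-(1 / ε)) := by
    rw [Real.rpow_neg ha0.le, ← one_div, le_div_iff₀ (by positivity)]
    exact hxa
  have h2 : 2 * ε * s - 1 ≤ (⌊2 * ε * s⌋₊ : ℝ) := (Nat.sub_one_lt_floor _).le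
  calc a ^ s * x ^ ⌊2 * ε * s⌋₊ ≤ a ^ s * (a ^ (-(1 / ε))) ^ ⌊2 * ε * s⌋₊ := by gcongr
    _ = a ^ ((s : ℝ) + -(1 / ε) * (⌊2 * ε * s⌋₊ : ℝ)) := by
        rw [Real.rpow_add ha0, Real.rpow_natCast, Real.rpow_mul ha0.le, Real.rpow_natCast]
    _ ≤ a ^ (1 / ε) := by
        refine Real.rpow_le_rpow_of_exponent_le ha ?_
        have h3 : (1 / ε) * (2 * ε * s - 1) ≤ 1 / ε * (⌊2 * ε * s⌋₊ : ℝ) := by gcongr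
        have h4 : (1 / ε) * (2 * ε * s - 1) = 2 * s - 1 / ε := by field_simp
        have h5 : (0 : ℝ) ≤ s := Nat.cast_nonneg s
        linarith

namespace Multitasking

lemma averageDegree_mul_card {V : Type*} [Fintype V] [Nonempty V] (G : SimpleGraph V) :
    averageDegree G * Fintype.card V = 2 * G.edgeSet.ncard := by
  classical
  unfold averageDegree
  have hV : (Fintype.card V : ℝ) ≠ 0 := by exact_mod_cast Fintype.card_ne_zero
  rw [div_mul_cancel₀ _ hV, ← coe_edgeFinset, Set.ncard_coe_finset]
  exact_mod_cast G.sum_degrees_eq_twice_card_edges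

lemma card_div_le_averageDegree {ι : Type*} {n : ℕ} (hn : 0 < n)
    (G : SimpleGraph (Fin n ⊕ Fin n)) (S : Finset ι) (φ : ι → Fin n × Fin n)
    (hφ : Set.InjOn φ S) (hadj : ∀ i ∈ S, G.Adj (Sum.inl (φ i).1) (Sum.inr (φ i).2)) :
    (S.card : ℝ) / n ≤ averageDegree G := by
  have : Nonempty (Fin n) := ⟨⟨0, hn⟩⟩
  have hn' : (0 : ℝ) < n := by exact_mod_cast hn
  have h := averageDegree_mul_card G
  have hle : S.card ≤ G.edgeSet.ncard := by
    rw [← Set.ncard_coe_finset]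
    refine Set.ncard_le_ncard_of_injOn (fun i => s(Sum.inl (φ i).1, Sum.inr (φ i).2)) hadj ?_
    intro i hi j hj hij
    refine hφ hi hj ?_
    simp at hij
    exact Prod.ext hij.1 hij.2
  have hle' : (S.card : ℝ) ≤ G.edgeSet.ncard := by exact_mod_cast hle
  simp only [Fintype.card_sum, Fintype.card_fin] at h
  push_cast at h
  rw [div_le_iff₀ hn']
  linarith

end Multitasking

/-! ### The random bipartite graph -/

namespace Multitasking

/-- The bipartite graph joining `i` on the left to `f (i, t)` on the right for all pairs `(i, t)`
outside `D`. -/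
def graphOfFun {n d : ℕ} (f : Fin n × Fin d → Fin n) (D : Finset (Fin n × Fin d)) :
    SimpleGraph (Fin n ⊕ Fin n) :=
  fromRel fun u v => ∃ p ∉ D, u = Sum.inl p.1 ∧ v = Sum.inr (f p)

lemma graphOfFun_isBipartiteWith {n d : ℕ} (f : Fin n × Fin d → Fin n)
    (D : Finset (Fin n × Fin d)) :
    (graphOfFun f D).IsBipartiteWith (Set.range Sum.inl) (Set.range Sum.inr) where
  disjoint := Set.isCompl_range_inl_range_inr.disjoint
  mem_of_adj := by
    rintro u v ⟨-, ⟨p, -, rfl, rfl⟩ | ⟨p, -, rfl, rfl⟩⟩ <;> simp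

lemma graphOfFun_adj {n d : ℕ} {f : Fin n × Fin d → Fin n} {D : Finset (Fin n × Fin d)}
    {i j : Fin n} :
    (graphOfFun f D).Adj (Sum.inl i) (Sum.inr j) ↔ ∃ p ∉ D, p.1 = i ∧ f p = j := by
  simp [graphOfFun, fromRel_adj, eq_comm]

/-- The triples of a set of `s` left vertices, a set of `s` right vertices and a set of `m` edge
slots at the left set. -/
def configurations (n d s m : ℕ) :
    Finset (Σ _ : Finset (Fin n) × Finset (Fin n), Finset (Fin n × Fin d)) :=
  (Finset.powersetCard s Finset.univ ×ˢ Finset.powersetCard s Finset.univ).sigma fun AB =>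
    Finset.powersetCard m (AB.1 ×ˢ Finset.univ)

lemma mem_configurations {n d s m : ℕ}
    {i : Σ _ : Finset (Fin n) × Finset (Fin n), Finset (Fin n × Fin d)} :
    i ∈ configurations n d s m ↔ (i.1.1.card = s ∧ i.1.2.card = s) ∧
      i.2 ⊆ i.1.1 ×ˢ Finset.univ ∧ i.2.card = m := by
  simp [configurations, Finset.mem_powersetCard]

lemma card_configurations (n d s m : ℕ) :
    (configurations n d s m).card = n.choose s ^ 2 * (s * d).choose m := by
  rw [configurations, Finset.card_sigma, Finset.sum_congr rfl (g := fun _ => (s * d).choose m)]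
  · simp [Finset.card_product, sq]
  · intro AB hAB
    simp only [Finset.mem_product, Finset.mem_powersetCard] at hAB
    simp [Finset.card_product, hAB.1.2]

lemma exists_sparse_fun (n d k : ℕ) (ε : ℝ) (hn : 0 < n) (hd : 0 < d)
    (hε : 0 < ε) (hk : 2 * (k * d) * (16 * (d : ℝ) ^ 2) ^ (1 / ε) ≤ n) :
    ∃ (f : Fin n × Fin d → Fin n) (D : Finset (Fin n × Fin d)),
      (D.card : ℝ) ≤ n * d / 2 ∧ ∀ s, 1 ≤ s → s ≤ k → ∀ (A B : Finset (Fin n))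
        (Q : Finset (Fin n × Fin d)), A.card = s → B.card = s → Q ⊆ A ×ˢ Finset.univ →
        Q.card = 2 * s + ⌊2 * ε * s⌋₊ → (∀ q ∈ Q, f q ∈ B) → ∃ q ∈ Q, q ∈ D := by
  have : Nonempty (Fin n) := ⟨⟨0, hn⟩⟩
  have hn' : (0 : ℝ) < n := by exact_mod_cast hn
  have hd' : (1 : ℝ) ≤ d := by exact_mod_cast hd
  have ha : (1 : ℝ) ≤ 16 * (d : ℝ) ^ 2 := by nlinarith
  let 𝒮 := (Finset.Icc 1 k).sigma fun s => configurations n d s (2 * s + ⌊2 * ε * s⌋₊)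
  have hsum : ∑ i ∈ 𝒮, ((i.2.1.2.card : ℝ) / Fintype.card (Fin n)) ^ i.2.2.card ≤ n * d / 2 := by
    rw [Finset.sum_sigma]
    have h1 : ∀ s ∈ Finset.Icc 1 k, ∑ i ∈ configurations n d s (2 * s + ⌊2 * ε * s⌋₊),
        ((i.1.2.card : ℝ) / Fintype.card (Fin n)) ^ i.2.card ≤
          (16 * (d : ℝ) ^ 2) ^ (1 / ε) := by
      intro s hs
      have hsk : (s : ℝ) ≤ k := by exact_mod_cast (Finset.mem_Icc.1 hs).2
      rw [Finset.sum_congr rfl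
        (g := fun _ => ((s : ℝ) / n) ^ (2 * s + ⌊2 * ε * s⌋₊)) fun i hi => by
          obtain ⟨⟨-, h2⟩, -, h3⟩ := mem_configurations.1 hi
          rw [h2, h3, Fintype.card_fin], Finset.sum_const, card_configurations, nsmul_eq_mul]
      push_cast
      refine (choose_sq_mul_choose_mul_pow_le n d s _ hn).trans
        (pow_mul_pow_floor_le ha hε (by positivity) ?_ s)
      rw [div_mul_eq_mul_div, div_le_one hn']
      have hsd : (s : ℝ) * d ≤ 2 * (k * d) := by
        have : (s : ℝ) * d ≤ k * d := by gcongr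
        have : (0 : ℝ) ≤ k * d := by positivity
        linarith
      exact (mul_le_mul_of_nonneg_right hsd (by positivity)).trans hk
    refine (Finset.sum_le_sum h1).trans ?_
    rw [Finset.sum_const, Nat.card_Icc, nsmul_eq_mul, Nat.add_sub_cancel]
    have h2 : (k : ℝ) * (16 * (d : ℝ) ^ 2) ^ (1 / ε) ≤
        (k * d) * (16 * (d : ℝ) ^ 2) ^ (1 / ε) := by
      gcongr
      exact le_mul_of_one_le_right (Nat.cast_nonneg k) hd'
    nlinarith
  obtain ⟨f, D, hD, hf⟩ := exists_fun_hitting_set 𝒮 (fun i => i.2.2) (fun i => i.2.1.2) (by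
    intro i hi
    obtain ⟨h1, h2⟩ := Finset.mem_sigma.1 hi
    have := (mem_configurations.1 h2).2.2
    have := (Finset.mem_Icc.1 h1).1
    exact Finset.card_pos.1 (by omega)) _ hsum
  refine ⟨f, D, hD, fun s hs1 hsk A B Q hA hB hQA hQ hQB => ?_⟩
  exact hf ⟨s, (A, B), Q⟩ (Finset.mem_sigma.2
    ⟨Finset.mem_Icc.2 ⟨hs1, hsk⟩, mem_configurations.2 ⟨⟨hA, hB⟩, hQA, hQ⟩⟩) hQB

lemma exists_isLocallySparse (n d k : ℕ) (ε : ℝ) (hn : 0 < n) (hd : 0 < d) (hk1 : 1 ≤ k)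
    (hε : 0 < ε) (hε2 : ε < 1 / 2) (hk : 2 * (k * d) * (16 * (d : ℝ) ^ 2) ^ (1 / ε) ≤ n) :
    ∃ G : SimpleGraph (Fin n ⊕ Fin n),
      G.IsBipartiteWith (Set.range Sum.inl) (Set.range Sum.inr) ∧
      (d : ℝ) / 2 ≤ averageDegree G ∧ IsLocallySparse G k (2 * ε) := by
  classical
  obtain ⟨f, D, hD, hf⟩ := exists_sparse_fun n d k ε hn hd hε hk
  have hn' : (0 : ℝ) < n := by exact_mod_cast hn
  refine ⟨graphOfFun f D, graphOfFun_isBipartiteWith f D, ?_, ?_⟩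
  · refine le_trans ?_ (card_div_le_averageDegree hn _ Dᶜ (fun p => (p.1, f p)) ?_ ?_)
    · rw [Finset.card_compl, Nat.cast_sub (Finset.card_le_univ D), le_div_iff₀ hn']
      simp only [Fintype.card_prod, Fintype.card_fin, Nat.cast_mul]
      linarith
    · intro p hp q hq hpq
      by_contra hne
      have hpq' := Prod.ext_iff.1 hpq
      simp only at hpq'
      -- For `s = 1` and `ε < 1/2` a forbidden configuration is a pair of slots giving the same
      -- edge. Hence surviving slots give distinct edges, and deletions need not be counted
      -- separately for repetitions.
      have hfl : ⌊2 * ε * ((1 : ℕ) : ℝ)⌋₊ = 0 := Nat.floor_eq_zero.2 (by push_cast; linarith)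
      obtain ⟨e, he, heD⟩ := hf 1 le_rfl hk1 {p.1} {f p} {p, q} (by simp) (by simp)
        (by
          intro e he
          rcases Finset.mem_insert.1 he with rfl | he
          · simp
          · rw [Finset.mem_singleton.1 he]
            simp [hpq'.1])
        (by rw [Finset.card_pair hne, hfl])
        (by simp [hpq'.2])
      rcases Finset.mem_insert.1 he with rfl | he
      · exact Finset.mem_compl.1 hp heD
      · rw [Finset.mem_singleton.1 he] at heD
        exact Finset.mem_compl.1 hq heD
    · intro p hp
      exact graphOfFun_adj.2 ⟨p, Finset.mem_compl.1 hp, rfl, rfl⟩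
  · intro A B hAB hA hAk
    set s := A.ncard with hs
    have hs1 : 1 ≤ s := (Set.ncard_pos).2 hA
    let P : Finset (Fin n × Fin d) :=
      Finset.univ.filter fun p => p ∉ D ∧ p.1 ∈ A ∧ f p ∈ B
    -- Otherwise a forbidden configuration would avoid `D`. Strictness supplies the `+ 1` in
    -- `IsLocallySparse`.
    have hP : P.card < 2 * s + ⌊2 * ε * s⌋₊ := by
      by_contra! hle
      obtain ⟨Q, hQP, hQ⟩ := Finset.exists_subset_card_eq hle
      obtain ⟨q, hq, hqD⟩ := hf s hs1 hAk A.toFinset B.toFinset Q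
        (Set.ncard_eq_toFinset_card' A).symm (by rw [hAB, Set.ncard_eq_toFinset_card'])
        (fun q hq => by simpa using (Finset.mem_filter.1 (hQP hq)).2.2.1) hQ
        (fun q hq => by simpa using (Finset.mem_filter.1 (hQP hq)).2.2.2)
      exact (Finset.mem_filter.1 (hQP hq)).2.1 hqD
    have hle : {p : Fin n × Fin n | p.1 ∈ A ∧ p.2 ∈ B ∧
        (graphOfFun f D).Adj (Sum.inl p.1) (Sum.inr p.2)}.ncard ≤ P.card := by
      rw [← Set.ncard_coe_finset]
      refine (Set.ncard_le_ncard (t := (fun p => (p.1, f p)) '' (P : Set (Fin n × Fin d))) ?_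
        (Set.toFinite _)).trans (Set.ncard_image_le (Set.toFinite _))
      rintro ⟨i, j⟩ ⟨hi, hj, hij⟩
      obtain ⟨p, hpD, rfl, rfl⟩ := graphOfFun_adj.1 hij
      exact ⟨p, by simpa [P] using ⟨hpD, hi, hj⟩, rfl⟩
    have h1 : (({p : Fin n × Fin n | p.1 ∈ A ∧ p.2 ∈ B ∧
        (graphOfFun f D).Adj (Sum.inl p.1) (Sum.inr p.2)}.ncard : ℕ) : ℝ) + 1 ≤
          ((2 * s + ⌊2 * ε * s⌋₊ : ℕ) : ℝ) := by
      exact_mod_cast hle.trans_lt hP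
    have h2 : (⌊2 * ε * s⌋₊ : ℝ) ≤ 2 * ε * s := Nat.floor_le (by positivity)
    push_cast at h1
    linarith

/-! ### The explicit size bound -/

/-- Since `ε < 1`, the factor 2 is at most `2^(1/ε)`. Comparing the bases of the `1/ε` powers leaves
`32 d² ≤ (101 e⁵)⁴ d⁸`. -/
lemma sizeBound_mul_le (n d : ℕ) (ε : ℝ) (hd : 1 ≤ d) (hε : 0 < ε) (hε1 : ε < 1) :
    2 * (sizeBound n d ε * d) * (16 * (d : ℝ) ^ 2) ^ (1 / ε) ≤ n := by
  have hd' : (1 : ℝ) ≤ d := by exact_mod_cast hd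
  have hd0 : (0 : ℝ) < d := by linarith
  set c : ℝ := 101 * Real.exp 5 with hc
  have hc32 : 32 ≤ c ^ 4 := by
    have h1 : (1 : ℝ) ≤ Real.exp 5 := Real.one_le_exp (by norm_num)
    have h2 : (101 : ℝ) ≤ c := by rw [hc]; linarith
    calc (32 : ℝ) ≤ 101 ^ 4 := by norm_num
      _ ≤ c ^ 4 := by gcongr
  have hc0 : 0 < c := by positivity
  have hε' : 1 ≤ 1 / ε := by rw [le_div_iff₀ hε]; linarith
  have e1 : (1 / c) ^ (4 / ε) = ((c ^ 4) ^ (1 / ε))⁻¹ := by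
    rw [one_div, Real.inv_rpow hc0.le, ← Real.rpow_natCast c 4, ← Real.rpow_mul hc0.le]
    congr 2
    push_cast
    ring
  have e2 : (d : ℝ) ^ (1 + 8 / ε) = d * ((d : ℝ) ^ 8) ^ (1 / ε) := by
    rw [Real.rpow_add hd0, Real.rpow_one, ← Real.rpow_natCast (d : ℝ) 8, ← Real.rpow_mul hd0.le]
    congr 2
    push_cast
    ring
  have h2 : (2 : ℝ) ≤ 2 ^ (1 / ε) := by
    simpa using Real.rpow_le_rpow_of_exponent_le (x := 2) (by norm_num) hε'
  have key : 2 * (16 * (d : ℝ) ^ 2) ^ (1 / ε) ≤ (c ^ 4) ^ (1 / ε) * ((d : ℝ) ^ 8) ^ (1 / ε) := by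
    rw [← Real.mul_rpow (by positivity) (by positivity)]
    calc 2 * (16 * (d : ℝ) ^ 2) ^ (1 / ε) ≤ 2 ^ (1 / ε) * (16 * (d : ℝ) ^ 2) ^ (1 / ε) := by
          gcongr
      _ = (32 * (d : ℝ) ^ 2) ^ (1 / ε) := by
          rw [← Real.mul_rpow (by positivity) (by positivity)]
          congr 1
          ring
      _ ≤ (c ^ 4 * (d : ℝ) ^ 8) ^ (1 / ε) := by
          gcongr
          norm_num
  rw [sizeBound, e1, e2]
  have hX : 0 < (c ^ 4) ^ (1 / ε) * ((d : ℝ) ^ 8) ^ (1 / ε) := by positivity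
  calc _ = n * (2 * (16 * (d : ℝ) ^ 2) ^ (1 / ε) /
        ((c ^ 4) ^ (1 / ε) * ((d : ℝ) ^ 8) ^ (1 / ε))) := by
        field_simp
    _ ≤ n * 1 := by
        gcongr
        exact (div_le_one hX).2 key
    _ = n := mul_one _

lemma exists_sizeBound_eq (n d : ℕ) (ε : ℝ) (hd : 2 ≤ d) (hε : 0 < ε) :
    ∃ θ : ℝ, 0 ≤ θ ∧
      θ ≤ (8 + 4 * Real.log (101 * Real.exp 5) / Real.log 2) / ε ∧
      sizeBound n d ε = (n : ℝ) / (d : ℝ) ^ (1 + θ) := by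
  have hd' : (2 : ℝ) ≤ d := by exact_mod_cast hd
  have hd0 : (0 : ℝ) < d := by linarith
  set c : ℝ := 101 * Real.exp 5 with hc
  have hc1 : 1 ≤ c := by
    have h1 : (1 : ℝ) ≤ Real.exp 5 := Real.one_le_exp (by norm_num)
    rw [hc]
    linarith
  have hc0 : 0 < c := by linarith
  have hlc : 0 ≤ Real.log c := Real.log_nonneg hc1
  have hl2 : 0 < Real.log 2 := Real.log_pos (by norm_num)
  have hld : Real.log 2 ≤ Real.log d := Real.log_le_log (by norm_num) hd'
  have hld0 : 0 < Real.log d := hl2.trans_le hld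
  -- This `θ` solves `d^θ = d^(8/ε) c^(4/ε)`; its bound uses `log d ≥ log 2`.
  refine ⟨(8 + 4 * Real.log c / Real.log d) / ε, by positivity, by gcongr, ?_⟩
  have e1 : (d : ℝ) ^ (1 + (8 + 4 * Real.log c / Real.log d) / ε) =
      (d : ℝ) ^ (1 + 8 / ε) * c ^ (4 / ε) := by
    rw [Real.rpow_def_of_pos hd0, Real.rpow_def_of_pos hd0, Real.rpow_def_of_pos hc0,
      ← Real.exp_add]
    congr 1
    field_simp
    ring
  rw [sizeBound, e1, one_div, Real.inv_rpow hc0.le]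
  field_simp

end Multitasking

theorem mainTheorem2 :
    ∃ (N : ℕ) (C : ℝ), 0 < C ∧
      ∀ (n d : ℕ) (ε : ℝ), N ≤ n → 1 ≤ d → d ≤ n → 0 < ε → ε < 1 →
        20 * Real.log (d : ℝ) / Real.log (n : ℝ) ≤ ε →
        (∃ G : SimpleGraph (Fin n ⊕ Fin n),
          G.IsBipartiteWith (Set.range Sum.inl) (Set.range Sum.inr) ∧
          (d : ℝ) / 2 ≤ Multitasking.averageDegree G ∧
          1 / 2 - ε ≤ Multitasking.capacityLE G ⌊Multitasking.sizeBound n d ε⌋₊) ∧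
        (2 ≤ d → ∃ θ : ℝ, 0 ≤ θ ∧ θ ≤ C / ε ∧
          Multitasking.sizeBound n d ε = (n : ℝ) / (d : ℝ) ^ (1 + θ)) := by
  have hlog : 0 ≤ Real.log (101 * Real.exp 5) := by
    refine Real.log_nonneg ?_
    have h1 : (1 : ℝ) ≤ Real.exp 5 := Real.one_le_exp (by norm_num)
    linarith
  have hl2 : 0 < Real.log 2 := Real.log_pos (by norm_num)
  refine ⟨0, 8 + 4 * Real.log (101 * Real.exp 5) / Real.log 2, by positivity, ?_⟩
  intro n d ε _ hd hdn hε hε1 _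
  refine ⟨?_, fun hd2 => Multitasking.exists_sizeBound_eq n d ε hd2 hε⟩
  have hn : 0 < n := by omega
  set k := ⌊Multitasking.sizeBound n d ε⌋₊ with hkdef
  by_cases hcase : 1 ≤ k ∧ ε < 1 / 2
  · obtain ⟨hk1, hε2⟩ := hcase
    have hkle : (k : ℝ) ≤ Multitasking.sizeBound n d ε :=
      Nat.floor_le (by unfold Multitasking.sizeBound; positivity)
    obtain ⟨G, hG, hdeg, hs⟩ := Multitasking.exists_isLocallySparse n d k ε hn hd hk1 hε hε2
      (le_trans (by gcongr) (Multitasking.sizeBound_mul_le n d ε hd hε hε1))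
    refine ⟨G, hG, hdeg, Multitasking.le_capacityLE (by linarith) fun l _ hl => ?_⟩
    have := hs.isMultitasker hG hl
    rw [show (1 - 2 * ε) / 2 = 1 / 2 - ε by ring] at this
    exact Multitasking.le_capacity (by linarith) this
  -- If `k = 0` there is no constraint, and if `ε ≥ 1/2` the target is nonpositive, so only the
  -- average degree matters here.
  · refine ⟨completeBipartiteGraph (Fin n) (Fin n),
      ⟨Set.isCompl_range_inl_range_inr.disjoint, ?_⟩, ?_, ?_⟩
    · intro u v huv
      simp only [completeBipartiteGraph_adj] at huv
      rcases u with u | u <;> rcases v with v | v <;> simp at huv ⊢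
    · refine le_trans ?_ (Multitasking.card_div_le_averageDegree hn _ Finset.univ
        (fun p : Fin n × Fin n => p) (Function.injective_id.injOn) (by simp))
      have hdn' : (d : ℝ) ≤ n := by exact_mod_cast hdn
      have hn' : (0 : ℝ) < n := by exact_mod_cast hn
      rw [le_div_iff₀ hn']
      simp only [Finset.card_univ, Fintype.card_prod, Fintype.card_fin, Nat.cast_mul]
      nlinarith
    · refine Multitasking.le_capacityLE (by linarith) fun l hl1 hlk => ?_
      have hε2 : 1 / 2 ≤ ε := by
        by_contra! h
        exact hcase ⟨hl1.trans hlk, h⟩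
      exact le_trans (by linarith) (Multitasking.capacity_nonneg _ l)
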